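/- Let $H$ be an infinite-dimensional complex Hilbert space, let $K$ be an arbitrary complex Hilbert space, and let $\psi : B(H) \to B(K)$ be a normal positive linear map; that is, $\psi$ is linear, $\psi(a)\ge 0$ whenever $a \ge 0$, and $\psi$ is continuous with respect to the ultraweak ($\sigma$-weak) topologies of $B(H)$ and $B(K)$. Then $\psi$ is Toeplitz completely positive: for every $n\in\mathbb N$ and all operators $\tau_{-n+1},\dots,\tau_{n-1}\in B(H)$ for which the Toeplitz matrix $[\tau_{k-j}]_{k,j=1}^n$ is a positive operator on $\bigoplus_1^n H$, the matrix $[\psi(\tau_{k-j})]_{k,j=1}^n$ is a positive operator on $\bigoplus_1^n K$. -/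

import Mathlib

/-- The ultraweak (`σ`-weak) topology on `B(H)`: the coarsest topology for which all functionals
`a ↦ ∑ₖ ⟪y k, a (x k)⟫`, with `∑ₖ ‖x k‖² < ∞` and `∑ₖ ‖y k‖² < ∞`, are continuous. -/
@[reducible] noncomputable def ultraweakTopology (H : Type*) [NormedAddCommGroup H] [InnerProductSpace ℂ H] :
    TopologicalSpace (H →L[ℂ] H) :=
  ⨅ (x : ℕ → H) (y : ℕ → H) (_ : Summable fun k => ‖x k‖ ^ 2) (_ : Summable fun k => ‖y k‖ ^ 2),
    TopologicalSpace.induced (fun a : H →L[ℂ] H => ∑' k, inner ℂ (y k) (a (x k))) inferInstance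

/-- A linear map `B(H) → B(K)` is normal if it is continuous for the ultraweak topologies. -/
def IsNormalMap {H K : Type*} [NormedAddCommGroup H] [InnerProductSpace ℂ H]
    [NormedAddCommGroup K] [InnerProductSpace ℂ K]
    (ψ : (H →L[ℂ] H) →ₗ[ℂ] (K →L[ℂ] K)) : Prop :=
  @Continuous _ _ (ultraweakTopology H) (ultraweakTopology K) ψ

/-- The operator on the Hilbert space direct sum of `n` copies of `H` that is given by an
`n × n` matrix of operators on `H`. -/
noncomputable def blockOperator {H : Type*} [NormedAddCommGroup H] [InnerProductSpace ℂ H]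
    {n : ℕ} (A : Matrix (Fin n) (Fin n) (H →L[ℂ] H)) :
    PiLp 2 (fun _ : Fin n => H) →L[ℂ] PiLp 2 (fun _ : Fin n => H) :=
  (PiLp.continuousLinearEquiv 2 ℂ (fun _ : Fin n => H)).symm.toContinuousLinearMap ∘L
    ContinuousLinearMap.pi fun i => ∑ j, A i j ∘L PiLp.proj 2 (fun _ : Fin n => H) j

theorem blockOperator_apply {H : Type*} [NormedAddCommGroup H] [InnerProductSpace ℂ H]
    {n : ℕ} (A : Matrix (Fin n) (Fin n) (H →L[ℂ] H)) (x : PiLp 2 (fun _ : Fin n => H))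
    (i : Fin n) : blockOperator A x i = ∑ j, A i j (x j) := by
  simp [blockOperator]

/-- The `n × n` Toeplitz matrix `[τ (k - j)]`, with row index `k` and column index `j`.
Only the values `τ ℓ` with `-n < ℓ < n` occur in it. -/
def toeplitzMatrix {R : Type*} (n : ℕ) (τ : ℤ → R) : Matrix (Fin n) (Fin n) R :=
  Matrix.of fun k j => τ ((k : ℤ) - (j : ℤ))

/-- A linear map `ψ : B(H) → B(K)` is Toeplitz completely positive if, for every `n`, its
entrywise application sends each positive `n × n` Toeplitz matrix over `B(H)` to a positive
matrix over `B(K)`. -/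
def IsToeplitzCompletelyPositive {H K : Type*} [NormedAddCommGroup H] [InnerProductSpace ℂ H]
    [NormedAddCommGroup K] [InnerProductSpace ℂ K]
    (ψ : (H →L[ℂ] H) →ₗ[ℂ] (K →L[ℂ] K)) : Prop :=
  ∀ (n : ℕ) (τ : ℤ → (H →L[ℂ] H)), (blockOperator (toeplitzMatrix n τ)).IsPositive →
    (blockOperator ((toeplitzMatrix n τ).map ψ)).IsPositive

/-!
A positive `n × n` Toeplitz matrix is the Gram matrix `[B_k† B_j]` of a family of operators whose
Gram matrix is shift invariant, so by Douglas' lemma some contraction carries each `B_j` to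
`B_{j+1}`. Its powers, together with those of its adjoint, extend the entries of the matrix to a
sequence on all of `ℤ` whose Fejér sums are positive on the unit circle, and linear positive maps
preserve this positivity. Conversely, positivity of the Fejér sums of a sequence makes its Toeplitz
matrices positive: test the sums at `z` on `∑ₐ zᵃ xₐ`, average over roots of unity of large order to
isolate the Toeplitz form, and take Cesàro limits.
-/

open scoped ComplexOrder InnerProductSpace

open ContinuousLinearMap (adjoint)

theorem exists_contraction_comp_eq {𝕜 G F F' : Type*} [RCLike 𝕜] [AddCommGroup G] [Module 𝕜 G]
    [NormedAddCommGroup F] [InnerProductSpace 𝕜 F] [CompleteSpace F]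
    [NormedAddCommGroup F'] [NormedSpace 𝕜 F'] [CompleteSpace F']
    (c : G →ₗ[𝕜] F') (d : G →ₗ[𝕜] F) (h : ∀ x, ‖c x‖ ≤ ‖d x‖) :
    ∃ V : F →L[𝕜] F', ‖V‖ ≤ 1 ∧ ∀ x, V (d x) = c x := by
  let S : Submodule 𝕜 F := (LinearMap.range d).topologicalClosure
  have : CompleteSpace S := (Submodule.isClosed_topologicalClosure _).completeSpace_coe
  let e : G →ₗ[𝕜] S := d.codRestrict S fun x =>
    Submodule.le_topologicalClosure _ (LinearMap.mem_range_self d x)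
  have he_dense : DenseRange e := by
    intro y
    have himage : (↑) '' Set.range e = (LinearMap.range d : Set F) :=
      (Set.range_comp ((↑) : S → F) e).symm
    rw [closure_subtype, himage]
    exact y.2
  have hnorm : ∀ x, ‖c x‖ ≤ 1 * ‖e x‖ := fun x => (h x).trans_eq (one_mul ‖e x‖).symm
  refine ⟨c.extendOfNorm e ∘L S.orthogonalProjectionOnto, ?_, fun x => ?_⟩
  · exact (ContinuousLinearMap.opNorm_comp_le _ _).trans <|
      mul_le_one₀ (LinearMap.opNorm_extendOfNorm_le he_dense zero_le_one hnorm)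
        (norm_nonneg _) S.orthogonalProjectionOnto_norm_le
  · have hproj : S.orthogonalProjectionOnto (d x) = e x :=
      Submodule.orthogonalProjectionOnto_mem_subspace_eq_self (e x)
    rw [ContinuousLinearMap.comp_apply, hproj]
    exact LinearMap.extendOfNorm_eq he_dense ⟨1, hnorm⟩ x

theorem exists_contraction_apply_castSucc_eq_apply_succ {𝕜 H E : Type*} [RCLike 𝕜]
    [AddCommGroup H] [Module 𝕜 H] [NormedAddCommGroup E] [InnerProductSpace 𝕜 E] [CompleteSpace E]
    {m : ℕ} (B : Fin (m + 1) → H →ₗ[𝕜] E)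
    (hB : ∀ (i j : Fin m) g h,
      ⟪B i.succ g, B j.succ h⟫_𝕜 = ⟪B i.castSucc g, B j.castSucc h⟫_𝕜) :
    ∃ V : E →L[𝕜] E, ‖V‖ ≤ 1 ∧ ∀ i h, V (B (Fin.castSucc i) h) = B i.succ h := by
  have hnorm (g : Fin m → H) : ‖∑ i, B i.succ (g i)‖ = ‖∑ i, B i.castSucc (g i)‖ := by
    simp only [@norm_eq_sqrt_re_inner 𝕜, sum_inner, inner_sum, hB]
  obtain ⟨V, hV, hVB⟩ := exists_contraction_comp_eq
    (LinearMap.lsum 𝕜 (fun _ => H) 𝕜 fun i : Fin m => B i.succ)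
    (LinearMap.lsum 𝕜 (fun _ => H) 𝕜 fun i : Fin m => B i.castSucc)
    fun g => by simpa [LinearMap.lsum_apply] using (hnorm g).le
  exact ⟨V, hV, fun i h => by
    simpa only [LinearMap.lsum_piSingle] using hVB (Pi.single i h)⟩

theorem exists_inner_map_map_eq_of_isPositive {E : Type*} [NormedAddCommGroup E]
    [InnerProductSpace ℂ E] [CompleteSpace E] {T : E →L[ℂ] E} (hT : T.IsPositive) :
    ∃ C : E →L[ℂ] E, ∀ x y, ⟪C x, C y⟫_ℂ = ⟪x, T y⟫_ℂ := by
  obtain ⟨C, rfl⟩ := CStarAlgebra.nonneg_iff_eq_star_mul_self.1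
    (T.nonneg_iff_isPositive.2 hT)
  exact ⟨C, fun x y => (C.adjoint_inner_right x (C y)).symm⟩

theorem isPositive_of_forall_inner_nonneg {E : Type*} [NormedAddCommGroup E]
    [InnerProductSpace ℂ E] {T : E →L[ℂ] E} (hT : ∀ x, 0 ≤ ⟪x, T x⟫_ℂ) : T.IsPositive := by
  refine T.isPositive_iff_complex.2 fun x => ?_
  have hx : 0 ≤ ⟪T x, x⟫_ℂ := by
    rw [← inner_conj_symm]
    exact star_nonneg_iff.2 (hT x)
  obtain ⟨hre, him⟩ := Complex.nonneg_iff.1 hx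
  exact ⟨Complex.ext rfl him, hre⟩

section BlockOperator

variable {H : Type*} [NormedAddCommGroup H] [InnerProductSpace ℂ H] {n : ℕ}

theorem inner_blockOperator (A : Matrix (Fin n) (Fin n) (H →L[ℂ] H))
    (x y : PiLp 2 (fun _ : Fin n => H)) :
    ⟪x, blockOperator A y⟫_ℂ = ∑ i, ∑ j, ⟪x i, A i j (y j)⟫_ℂ := by
  simp only [PiLp.inner_apply, blockOperator_apply, inner_sum]

theorem inner_single_blockOperator_single (A : Matrix (Fin n) (Fin n) (H →L[ℂ] H))
    (i j : Fin n) (g h : H) :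
    ⟪PiLp.single 2 i g, blockOperator A (PiLp.single 2 j h)⟫_ℂ = ⟪g, A i j h⟫_ℂ := by
  rw [inner_blockOperator, Fintype.sum_eq_single i, Fintype.sum_eq_single j]
  · simp only [PiLp.single_eq_same]
  · intro k hk
    simp only [PiLp.single_eq_of_ne _ hk, map_zero, inner_zero_right]
  · intro k hk
    simp only [PiLp.single_eq_of_ne _ hk, inner_zero_left, Finset.sum_const_zero]

theorem exists_inner_eq_of_isPositive_blockOperator [CompleteSpace H]
    {A : Matrix (Fin n) (Fin n) (H →L[ℂ] H)} (hA : (blockOperator A).IsPositive) :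
    ∃ B : Fin n → H →L[ℂ] PiLp 2 (fun _ : Fin n => H),
      ∀ i j g h, ⟪B i g, B j h⟫_ℂ = ⟪g, A i j h⟫_ℂ := by
  obtain ⟨C, hC⟩ := exists_inner_map_map_eq_of_isPositive hA
  refine ⟨fun i => C ∘L (PiLp.continuousLinearEquiv 2 ℂ fun _ : Fin n => H).symm ∘L
    ContinuousLinearMap.single ℂ (fun _ : Fin n => H) i, fun i j g h => ?_⟩
  rw [← inner_single_blockOperator_single, ← hC]
  rfl

end BlockOperator

section ToeplitzMatrix

variable {R S : Type*} {n : ℕ}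

theorem toeplitzMatrix_apply (τ : ℤ → R) (k j : Fin n) :
    toeplitzMatrix n τ k j = τ ((k : ℤ) - j) := rfl

theorem toeplitzMatrix_map (τ : ℤ → R) (f : R → S) :
    (toeplitzMatrix n τ).map f = toeplitzMatrix n (f ∘ τ) := rfl

theorem toeplitzMatrix_congr {σ τ : ℤ → R} (h : ∀ l : ℤ, |l| < n → σ l = τ l) :
    toeplitzMatrix n σ = toeplitzMatrix n τ := by
  ext k j
  exact h _ (by rw [abs_lt]; omega)

end ToeplitzMatrix

section StarZPow

variable {A : Type*} [Monoid A] [StarMul A]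

/-- The power `a ^ l` for `l ≥ 0` and `(star a) ^ (-l)` for `l < 0`. For a unitary `a` these are the
integer powers of `a`. -/
def starZPow (a : A) : ℤ → A
  | .ofNat k => a ^ k
  | .negSucc k => star a ^ (k + 1)

@[simp]
theorem starZPow_natCast (a : A) (k : ℕ) : starZPow a k = a ^ k := rfl

@[simp]
theorem starZPow_neg_natCast (a : A) (k : ℕ) : starZPow a (-(k : ℤ)) = star a ^ k := by
  cases k with
  | zero => simp [starZPow]
  | succ k => rfl

end StarZPow

theorem starZPow_smul {A : Type*} [Monoid A] [StarMul A] [MulAction ℂ A] [IsScalarTower ℂ A A]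
    [SMulCommClass ℂ A A] [StarModule ℂ A] {z : ℂ} (hz : ‖z‖ = 1) (a : A) (l : ℤ) :
    starZPow (z • a) l = z ^ l • starZPow a l := by
  have hstar : star z = z⁻¹ := (Complex.inv_eq_conj hz).symm
  obtain ⟨k, rfl | rfl⟩ := l.eq_nat_or_neg <;> simp [smul_pow, hstar]

section FejerSum

variable {𝕜 M M' : Type*} [DivisionRing 𝕜] [AddCommGroup M] [Module 𝕜 M] [AddCommGroup M']
  [Module 𝕜 M']

/-- The symmetric partial sum `∑_{|l| ≤ m} zˡ τ_l` of the Laurent series with coefficients `τ`. -/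
noncomputable def symmPartialSum (τ : ℤ → M) (z : 𝕜) (m : ℕ) : M :=
  ∑ l ∈ Finset.Icc (-m : ℤ) m, z ^ l • τ l

/-- The sum of the first `N` symmetric partial sums, that is, `N` times the Fejér mean. -/
noncomputable def fejerSum (τ : ℤ → M) (z : 𝕜) (N : ℕ) : M :=
  ∑ m ∈ Finset.range N, symmPartialSum τ z m

theorem symmPartialSum_succ (τ : ℤ → M) (z : 𝕜) (m : ℕ) :
    symmPartialSum τ z (m + 1) = z ^ (m + 1 : ℤ) • τ (m + 1) +
      z ^ (-(m + 1) : ℤ) • τ (-(m + 1)) + symmPartialSum τ z m := by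
  rw [symmPartialSum, Nat.cast_succ, Finset.sum_Icc_succ_eq_add_endpoints, symmPartialSum]

theorem map_fejerSum (f : M →ₗ[𝕜] M') (τ : ℤ → M) (z : 𝕜) (N : ℕ) :
    f (fejerSum τ z N) = fejerSum (f ∘ τ) z N := by
  simp only [fejerSum, symmPartialSum, map_sum, map_smul, Function.comp_apply]

end FejerSum

theorem symmPartialSum_starZPow {A : Type*} [Ring A] [StarRing A] [Algebra ℂ A]
    [StarModule ℂ A] (a : A) {z : ℂ} (hz : ‖z‖ = 1) (m : ℕ) :
    symmPartialSum (starZPow a) z m = z • a * ∑ i ∈ Finset.range m, (z • a) ^ i +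
      star (z • a * ∑ i ∈ Finset.range m, (z • a) ^ i) + 1 := by
  induction m with
  | zero => simp [symmPartialSum, starZPow]
  | succ m ih =>
    rw [symmPartialSum_succ, ih, ← starZPow_smul hz, ← starZPow_smul hz, ← Nat.cast_succ,
      starZPow_natCast, starZPow_neg_natCast, Finset.sum_range_succ, mul_add, star_add,
      ← pow_succ', star_pow]
    abel

section Contraction

variable {A : Type*} [CStarAlgebra A] [PartialOrder A] [StarOrderedRing A]

theorem star_mul_self_le_one {a : A} (ha : ‖a‖ ≤ 1) : star a * a ≤ 1 := by
  refine CStarAlgebra.star_mul_le_algebraMap_norm_sq.trans ?_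
  rw [← map_one (algebraMap ℝ A)]
  exact algebraMap_mono A (pow_le_one₀ (norm_nonneg a) ha)

theorem star_geom_sum_mul_self_le_fejerSum {a : A} (ha : ‖a‖ ≤ 1) {z : ℂ} (hz : ‖z‖ = 1) (N : ℕ) :
    star (∑ i ∈ Finset.range N, (z • a) ^ i) * ∑ i ∈ Finset.range N, (z • a) ^ i ≤
      fejerSum (starZPow a) z N := by
  induction N with
  | zero => simp [fejerSum]
  | succ N ih =>
    have hw : star (z • a) * (z • a) ≤ 1 :=
      star_mul_self_le_one (by rwa [norm_smul, hz, one_mul])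
    rw [geom_sum_succ, fejerSum, Finset.sum_range_succ, ← fejerSum, symmPartialSum_starZPow a hz]
    generalize ∑ i ∈ Finset.range N, (z • a) ^ i = s at ih ⊢
    generalize z • a = w at hw ⊢
    calc star (w * s + 1) * (w * s + 1)
        = star s * (star w * w) * s + (w * s + star (w * s) + 1) := by
          simp only [star_add, star_mul, star_one]
          noncomm_ring
      _ ≤ star s * s + (w * s + star (w * s) + 1) := by
          gcongr
          simpa using star_left_conjugate_le_conjugate hw s
      _ ≤ fejerSum (starZPow a) z N + (w * s + star (w * s) + 1) := by gcongr

theorem fejerSum_starZPow_nonneg {a : A} (ha : ‖a‖ ≤ 1) {z : ℂ} (hz : ‖z‖ = 1) (N : ℕ) :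
    0 ≤ fejerSum (starZPow a) z N :=
  (star_mul_self_nonneg _).trans (star_geom_sum_mul_self_le_fejerSum ha hz N)

end Contraction

section Extension

variable {H : Type*} [NormedAddCommGroup H] [InnerProductSpace ℂ H] [CompleteSpace H]

theorem exists_contraction_dilation {E : Type*} [NormedAddCommGroup E] [InnerProductSpace ℂ E]
    [CompleteSpace E] {m : ℕ} {τ : ℤ → (H →L[ℂ] H)} (B : Fin (m + 1) → H →L[ℂ] E)
    (hB : ∀ i j g h, ⟪B i g, B j h⟫_ℂ = ⟪g, toeplitzMatrix (m + 1) τ i j h⟫_ℂ) :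
    ∃ U : E →L[ℂ] E, ‖U‖ ≤ 1 ∧
      ∀ l : ℤ, |l| < (m + 1 : ℕ) → adjoint (B 0) ∘L starZPow U l ∘L B 0 = τ l := by
  obtain ⟨V, hV, hVB⟩ := exists_contraction_apply_castSucc_eq_apply_succ
    (fun i => (B i).toLinearMap) fun i j g h => by simp [hB, toeplitzMatrix_apply]
  have hpow (k : Fin (m + 1)) (h : H) : (V ^ (k : ℕ)) (B 0 h) = B k h := by
    induction k using Fin.induction with
    | zero => simp
    | succ i ih =>
      rw [Fin.val_succ, pow_succ', mul_apply_eq_comp, ← Fin.val_castSucc, ih]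
      exact hVB i h
  refine ⟨star V, by rwa [norm_star], fun l hl => ?_⟩
  ext h
  refine ext_inner_left ℂ fun g => ?_
  rw [ContinuousLinearMap.comp_apply, ContinuousLinearMap.adjoint_inner_right,
    ContinuousLinearMap.comp_apply]
  obtain ⟨k, rfl | rfl⟩ := l.eq_nat_or_neg
  · have hk : k < m + 1 := by simpa using hl
    rw [starZPow_natCast, ← star_pow, ContinuousLinearMap.star_eq_adjoint,
      ContinuousLinearMap.adjoint_inner_right, hpow ⟨k, hk⟩, hB]
    simp [toeplitzMatrix_apply]
  · have hk : k < m + 1 := by simpa using hl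
    rw [starZPow_neg_natCast, star_star, hpow ⟨k, hk⟩, hB]
    simp [toeplitzMatrix_apply]

theorem exists_extension_fejerSum_isPositive {n : ℕ} {τ : ℤ → (H →L[ℂ] H)}
    (hτ : (blockOperator (toeplitzMatrix n τ)).IsPositive) :
    ∃ σ : ℤ → (H →L[ℂ] H), (∀ l : ℤ, |l| < n → σ l = τ l) ∧
      ∀ z : ℂ, ‖z‖ = 1 → ∀ N, (fejerSum σ z N).IsPositive := by
  cases n with
  | zero => exact ⟨0, fun l hl => absurd hl (by simp), fun z _ N => by
      simp [fejerSum, symmPartialSum]⟩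
  | succ m =>
    obtain ⟨B, hB⟩ := exists_inner_eq_of_isPositive_blockOperator hτ
    obtain ⟨U, hU, hUB⟩ := exists_contraction_dilation B hB
    refine ⟨fun l => adjoint (B 0) ∘L starZPow U l ∘L B 0, hUB, fun z hz N => ?_⟩
    have hpos := (ContinuousLinearMap.nonneg_iff_isPositive _).1 (fejerSum_starZPow_nonneg hU hz N)
    convert hpos.adjoint_conj (B 0) using 1
    ext h
    simp [fejerSum, symmPartialSum, sum_apply]

end Extension

theorem sum_pow_zpow_of_isPrimitiveRoot {R : Type*} [Field R] {M : ℕ} {ζ : R}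
    (hζ : IsPrimitiveRoot ζ M) {l : ℤ} (hl : |l| < M) :
    ∑ i ∈ Finset.range M, (ζ ^ i) ^ l = if l = 0 then (M : R) else 0 := by
  split_ifs with h
  · simp [h]
  · have hne : ζ ^ l ≠ 1 := fun h1 =>
      h (Int.eq_zero_of_abs_lt_dvd ((hζ.zpow_eq_one_iff_dvd l).1 h1) hl)
    have hcomm : ∀ i : ℕ, (ζ ^ i) ^ l = (ζ ^ l) ^ i := fun i => by
      rw [← zpow_natCast, ← zpow_natCast, zpow_comm]
    have hone : (ζ ^ l) ^ M = 1 := by rw [← hcomm, hζ.pow_eq_one, one_zpow]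
    simp only [hcomm]
    rw [geom_sum_eq hne, hone, sub_self, zero_div]

section Herglotz

variable {K : Type*} [NormedAddCommGroup K] [InnerProductSpace ℂ K] {n : ℕ}

/-- The quadratic form of the `n × n` Toeplitz matrix with entries `σ (a - b)`, with all diagonals
`|a - b| > m` replaced by zero. -/
noncomputable def bandedToeplitzForm (σ : ℤ → (K →L[ℂ] K)) (x : Fin n → K) (m : ℕ) : ℂ :=
  ∑ a : Fin n, ∑ b : Fin n, if |(a : ℤ) - b| ≤ m then ⟪x a, σ ((a : ℤ) - b) (x b)⟫_ℂ else 0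

theorem bandedToeplitzForm_of_le (σ : ℤ → (K →L[ℂ] K)) (x : PiLp 2 (fun _ : Fin n => K)) {m : ℕ}
    (hm : n ≤ m) : bandedToeplitzForm σ x m = ⟪x, blockOperator (toeplitzMatrix n σ) x⟫_ℂ := by
  rw [inner_blockOperator, bandedToeplitzForm]
  refine Finset.sum_congr rfl fun a _ => Finset.sum_congr rfl fun b _ => ?_
  rw [if_pos (by rw [abs_le]; omega), toeplitzMatrix_apply]

/-- The vector `∑ₐ zᵃ xₐ`, on which Fejér sums at `z` are tested. -/
noncomputable def modulatedSum (x : Fin n → K) (z : ℂ) : K := ∑ a : Fin n, z ^ (a : ℤ) • x a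

theorem inner_modulatedSum {z : ℂ} (hz : ‖z‖ = 1) (T : K →L[ℂ] K) (x : Fin n → K) :
    ⟪modulatedSum x z, T (modulatedSum x z)⟫_ℂ =
      ∑ a : Fin n, ∑ b : Fin n, z ^ ((b : ℤ) - a) * ⟪x a, T (x b)⟫_ℂ := by
  have hz0 : z ≠ 0 := norm_ne_zero_iff.1 (hz ▸ one_ne_zero)
  have hconj (a : ℤ) : starRingEnd ℂ (z ^ a) = z ^ (-a) := by
    rw [map_zpow₀, ← Complex.inv_eq_conj hz, inv_zpow']
  simp only [modulatedSum, map_sum, map_smul, sum_inner, inner_sum, inner_smul_left,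
    inner_smul_right, hconj, Finset.mul_sum]
  rw [Finset.sum_comm]
  refine Finset.sum_congr rfl fun a _ => Finset.sum_congr rfl fun b _ => ?_
  rw [sub_eq_neg_add, zpow_add₀ hz0]
  ring

theorem sum_inner_modulatedSum_symmPartialSum (σ : ℤ → (K →L[ℂ] K)) (x : Fin n → K) {m M : ℕ}
    {ζ : ℂ} (hζ : IsPrimitiveRoot ζ M) (hM : m + n < M) :
    ∑ i ∈ Finset.range M, ⟪modulatedSum x (ζ ^ i),
      symmPartialSum σ (ζ ^ i) m (modulatedSum x (ζ ^ i))⟫_ℂ = M * bandedToeplitzForm σ x m := by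
  have hnorm (i : ℕ) : ‖ζ ^ i‖ = 1 := by
    rw [norm_pow, hζ.norm'_eq_one (by omega), one_pow]
  have horth (a b : Fin n) {l : ℤ} (hl : l ∈ Finset.Icc (-m : ℤ) m) :
      ∑ i ∈ Finset.range M, (ζ ^ i) ^ ((b : ℤ) - a) * (ζ ^ i) ^ l =
        if (a : ℤ) - b = l then (M : ℂ) else 0 := by
    have hlM : |(b : ℤ) - a + l| < M := by
      rw [Finset.mem_Icc] at hl
      rw [abs_lt]
      omega
    simp only [← zpow_add₀ (norm_ne_zero_iff.1 (hnorm _ ▸ one_ne_zero)),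
      sum_pow_zpow_of_isPrimitiveRoot hζ hlM]
    congr 1
    exact propext (by omega)
  simp only [inner_modulatedSum (hnorm _)]
  simp only [symmPartialSum, sum_apply, smul_apply, inner_sum, inner_smul_right, Finset.mul_sum,
    bandedToeplitzForm]
  rw [Finset.sum_comm]
  refine Finset.sum_congr rfl fun a _ => ?_
  rw [Finset.sum_comm]
  refine Finset.sum_congr rfl fun b _ => ?_
  calc ∑ i ∈ Finset.range M, ∑ l ∈ Finset.Icc (-m : ℤ) m,
        (ζ ^ i) ^ ((b : ℤ) - a) * ((ζ ^ i) ^ l * ⟪x a, σ l (x b)⟫_ℂ)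
      = ∑ l ∈ Finset.Icc (-m : ℤ) m,
          if (a : ℤ) - b = l then M * ⟪x a, σ l (x b)⟫_ℂ else 0 := by
        rw [Finset.sum_comm]
        refine Finset.sum_congr rfl fun l hl => ?_
        simp only [← mul_assoc, ← Finset.sum_mul, horth a b hl, ite_mul, zero_mul]
    _ = M * if |(a : ℤ) - b| ≤ m then ⟪x a, σ ((a : ℤ) - b) (x b)⟫_ℂ else 0 := by
        simp only [Finset.sum_ite_eq, Finset.mem_Icc, ← abs_le, mul_ite, mul_zero]

theorem sum_bandedToeplitzForm_nonneg {σ : ℤ → (K →L[ℂ] K)} {N : ℕ}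
    (hσ : ∀ z : ℂ, ‖z‖ = 1 → (fejerSum σ z N).IsPositive) (x : Fin n → K) :
    0 ≤ ∑ m ∈ Finset.range N, bandedToeplitzForm σ x m := by
  obtain ⟨M, hM⟩ : ∃ M, M = N + n + 1 := ⟨_, rfl⟩
  have hM0 : M ≠ 0 := by omega
  have hζ := Complex.isPrimitiveRoot_exp M hM0
  generalize Complex.exp _ = ζ at hζ
  have hmean : ∑ m ∈ Finset.range N, bandedToeplitzForm σ x m = (M : ℂ)⁻¹ *
      ∑ i ∈ Finset.range M,
        ⟪modulatedSum x (ζ ^ i), fejerSum σ (ζ ^ i) N (modulatedSum x (ζ ^ i))⟫_ℂ := by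
    simp only [fejerSum, sum_apply, inner_sum]
    rw [Finset.sum_comm, Finset.mul_sum]
    refine Finset.sum_congr rfl fun m hm => ?_
    rw [Finset.mem_range] at hm
    rw [sum_inner_modulatedSum_symmPartialSum σ x hζ (by omega),
      inv_mul_cancel_left₀ (Nat.cast_ne_zero.2 hM0)]
  rw [hmean]
  refine mul_nonneg (inv_nonneg.2 (Nat.cast_nonneg M)) (Finset.sum_nonneg fun i _ => ?_)
  exact (hσ _ (by rw [norm_pow, hζ.norm'_eq_one hM0, one_pow])).inner_nonneg_right _

theorem isPositive_blockOperator_toeplitzMatrix {σ : ℤ → (K →L[ℂ] K)}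
    (hσ : ∀ z : ℂ, ‖z‖ = 1 → ∀ N, (fejerSum σ z N).IsPositive) :
    (blockOperator (toeplitzMatrix n σ)).IsPositive := by
  refine isPositive_of_forall_inner_nonneg fun x => ?_
  have hlim : Filter.Tendsto (bandedToeplitzForm σ x) Filter.atTop
      (nhds ⟪x, blockOperator (toeplitzMatrix n σ) x⟫_ℂ) :=
    tendsto_atTop_of_eventually_const fun m => bandedToeplitzForm_of_le σ x
  refine ge_of_tendsto' hlim.cesaro_smul fun N => ?_
  exact smul_nonneg (by positivity) (sum_bandedToeplitzForm_nonneg (fun z hz => hσ z hz N) x)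

end Herglotz

theorem mainTheorem4_general {H : Type*} [NormedAddCommGroup H] [InnerProductSpace ℂ H]
    [CompleteSpace H] {K : Type*} [NormedAddCommGroup K] [InnerProductSpace ℂ K]
    (ψ : (H →L[ℂ] H) →ₗ[ℂ] (K →L[ℂ] K))
    (hpos : ∀ a : H →L[ℂ] H, a.IsPositive → (ψ a).IsPositive) :
    IsToeplitzCompletelyPositive ψ := by
  intro n τ hτ
  obtain ⟨σ, hστ, hσ⟩ := exists_extension_fejerSum_isPositive hτ
  rw [← toeplitzMatrix_congr hστ, toeplitzMatrix_map]
  refine isPositive_blockOperator_toeplitzMatrix fun z hz N => ?_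
  rw [← map_fejerSum]
  exact hpos _ (hσ z hz N)

theorem mainTheorem4 {H : Type*} [NormedAddCommGroup H] [InnerProductSpace ℂ H] [CompleteSpace H]
    (hH : ¬ FiniteDimensional ℂ H)
    {K : Type*} [NormedAddCommGroup K] [InnerProductSpace ℂ K] [CompleteSpace K]
    (ψ : (H →L[ℂ] H) →ₗ[ℂ] (K →L[ℂ] K))
    (hpos : ∀ a : H →L[ℂ] H, a.IsPositive → (ψ a).IsPositive)
    (hnormal : IsNormalMap ψ) :
    IsToeplitzCompletelyPositive ψ :=
  mainTheorem4_general ψ hpos
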